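/- Let $N/K$ be a (possibly infinite) Galois extension of fields and $G=\mathrm{Aut}(N/K)$ with the Krull topology. A place of a field is an equivalence class of nontrivial real-valued absolute values; $K_v$ denotes the completion of $K$ at the place $v$, and $w\mid v$ means that absolute values in $w$ restrict to absolute values in $v$. A place $v$ of $K$ is well behaved if $\sum_{w\mid v}[F_w:K_v]=[F:K]$ for every finite extension $F/K$. Let $\mathcal M_K$ be a set of places of $K$ with a choice of absolute values $\|\cdot\|_v\in v$ ($v\in\mathcal M_K$) that is proper: every $v\in\mathcal M_K$ is well behaved, and for every $\alpha\in K^\times$ one has $\|\alpha\|_v\neq 1$ for at most finitely many $v\in\mathcal M_K$ and $\prod_{v\in\mathcal M_K}\|\alpha\|_v=1$. Let $Y$ be the set of all places $y$ of $N$ lying over some place in $\mathcal M_K$. For a finite Galois extension $L/K$ with $L\subseteq N$ let $\psi_L(y)$ be the place of $L$ below $y\in Y$. Give $Y$ the topology with basis the sets $\psi_L^{-1}(w)$, where $L$ runs over these fields and $w$ over the places of $L$; then $Y$ is locally compact and Hausdorff, and $G$ acts on it by $\|\alpha\|_{\tau y}=\|\tau^{-1}\alpha\|_y$. Let $\mu$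 be the Haar measure on $G$ with $\mu(G)=1$, choose for each $v\in\mathcal M_K$ a place $z_v\in Y$ over $v$, and let $\lambda$ be the unique regular Borel measure on $Y$ with $$\int_Y F\,d\lambda=\sum_{v\in\mathcal M_K}\int_G F(\tau z_v)\,d\mu(\tau)\qquad\text{for all } F\in C_c(Y).$$ If $v\in\mathcal M_K$, if $L/K$ is a finite Galois extension with $L\subseteq N$, and if $w$ is a place of $L$ with $w\mid v$, then $$\lambda\bigl(\psi_L^{-1}(w)\bigr)=\frac{[L_w:K_v]}{[L:K]}.$$ In particular, let $K=\mathbb Q$, $N=\overline{\mathbb Q}$, and let $\mathcal M_{\mathbb Q}$ be the set of all places of $\mathbb Q$, so that $Y$ is the set of all places of $\overline{\mathbb Q}$. Then for every finite Galois extension $k/\mathbb Q$ with $k\subseteq\overline{\mathbb Q}$ and every place $v$ of $k$, the set $Y(k,v)=\{y\in Y: y\mid v\}$ satisfies $$\lambda\bigl(Y(k,v)\bigr)=\frac{[k_v:\mathbb Q_v]}{[k:\mathbb Q]},$$ where $\mathbb Q_v$ is the completion of $\mathbb Q$ at the place below $v$. -/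

import Mathlib

open MeasureTheory CompactlySupported
open scoped ENNReal

universe u

section AbsVal
variable {K L : Type*} [Field K] [Field L]

lemma absval_nontrivial_of_isIntegral (f : K →+* L) (hf : f.IsIntegral)
    (a : AbsoluteValue L ℝ) (ha : a.IsNontrivial) :
    (a.comp f.injective).IsNontrivial := by
  by_contra h
  rw [AbsoluteValue.not_isNontrivial_iff] at h
  let _ := f.toAlgebra
  have key : ∀ x : L, a x ≤ 1 := by
    intro x
    have hx : IsIntegral K x := hf x
    by_contra! hlt
    have hle : ∀ c : K, a (algebraMap K L c) ≤ 1 := by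
      intro c
      rcases eq_or_ne c 0 with rfl | hc
      · simp
      · exact (h c hc).le
    have hb : ∀ m : ℕ, a (x ^ m) ≤ ∑ i ∈ Finset.range (minpoly K x).natDegree, a x ^ i := by
      intro m
      let r := Polynomial.X ^ m %ₘ minpoly K x
      have h1 : x ^ m = Polynomial.aeval x r := by
        rw [Polynomial.aeval_modByMonic_eq_self_of_root (minpoly.aeval K x)]
        simp
      have h2 : r.natDegree < (minpoly K x).natDegree :=
        Polynomial.natDegree_modByMonic_lt _ (minpoly.monic hx) (minpoly.ne_one K x)
      rw [h1, Polynomial.aeval_eq_sum_range' h2]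
      refine (a.sum_le _ _).trans (Finset.sum_le_sum fun i _ => ?_)
      rw [Algebra.smul_def, map_mul, map_pow]
      exact mul_le_of_le_one_left (by positivity) (hle _)
    obtain ⟨m, hm⟩ := pow_unbounded_of_one_lt
      (∑ i ∈ Finset.range (minpoly K x).natDegree, a x ^ i) hlt
    exact absurd (hb m) (by simpa using hm)
  obtain ⟨x, hx⟩ := ha.exists_abv_gt_one
  exact absurd (key x) (not_le.2 hx)
end AbsVal

/-! ### Extension of absolute values to algebraic extensions -/

lemma exists_extension_nonarch {K N : Type*} [Field K] [Field N] [Algebra K N]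
    [Algebra.IsAlgebraic K N] (a : AbsoluteValue K ℝ) (ha : a.IsNontrivial)
    (hna : ∀ n : ℕ, a n ≤ 1) :
    ∃ b : AbsoluteValue N ℝ, b.comp (algebraMap K N).injective = a := by
  let C := a.Completion
  have hnorm : ∀ x : K, ‖((WithAbs.toAbs a x : WithAbs a) : C)‖ = a x := fun x => by
    rw [UniformSpace.Completion.norm_coe]; rfl
  let _ : NontriviallyNormedField C :=
    { (inferInstance : NormedField C) with
      non_trivial := by
        obtain ⟨x, hx⟩ := ha.exists_abv_gt_one
        exact ⟨_, by rw [hnorm]; exact hx⟩ }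
  have : IsUltrametricDist C := by
    refine isUltrametricDist_iff_forall_norm_natCast_le_one.2 fun n => ?_
    have := hnorm n
    have h2 : ((WithAbs.toAbs a (n : K) : WithAbs a) : C) = (n : C) :=
      map_natCast (UniformSpace.Completion.coeRingHom.comp
        ((WithAbs.equiv a).symm : K →+* WithAbs a)) n
    rw [← h2, this]
    exact hna n
  let E := AlgebraicClosure C
  let i : K →+* E := (algebraMap C E).comp (UniformSpace.Completion.coeRingHom.comp
        ((WithAbs.equiv a).symm : K →+* WithAbs a))
  let _ : Algebra K E := i.toAlgebra
  let φ : N →ₐ[K] E := IsAlgClosed.lift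
  let b : AbsoluteValue E ℝ :=
    { toFun := spectralMulAlgNorm C E
      map_mul' := map_mul _
      nonneg' := fun x => apply_nonneg _ x
      eq_zero' := fun x => map_eq_zero_iff_eq_zero _
      add_le' := map_add_le_add _ }
  refine ⟨b.comp (f := (φ : N →+* E)) (RingHom.injective _), ?_⟩
  ext x
  show spectralNorm C E (φ (algebraMap K N x)) = a x
  rw [φ.commutes]
  exact (spectralNorm_extends (K := C) (L := E) _).trans (hnorm x)

lemma exists_rpow_of_arch {K : Type*} [Field K] (a : AbsoluteValue K ℝ)
    (hna : ¬ ∀ n : ℕ, a n ≤ 1) :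
    ∃ f : AbsoluteValue K ℝ, a.IsEquiv f ∧ ∀ n : ℕ, f n = n := by
  have hchar : CharZero K := by
    refine charZero_of_inj_zero fun n hn => ?_
    by_contra h0
    push Not at hna
    obtain ⟨m, hm⟩ := hna
    obtain ⟨k, hk⟩ := pow_unbounded_of_one_lt (n : ℝ) hm
    have h1 : ((m ^ k % n : ℕ) : K) = (m : K) ^ k := by
      have := congrArg (Nat.cast (R := K)) (Nat.mod_add_div (m ^ k) n)
      push_cast at this
      rw [hn, zero_mul, add_zero] at this
      exact this
    have h2 : a ((m ^ k % n : ℕ) : K) ≤ n := by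
      have hle : ∀ j : ℕ, a (j : K) ≤ j := fun j => by
        induction j with
        | zero => simp
        | succ j ih =>
          push_cast
          exact (a.add_le _ _).trans (by rw [map_one]; gcongr)
      refine (hle _).trans ?_
      exact_mod_cast (Nat.mod_lt _ (Nat.pos_of_ne_zero h0)).le
    rw [h1, map_pow] at h2
    exact absurd h2 (not_le.2 hk)
  have hE := Rat.AbsoluteValue.equiv_real_of_unbounded
    (f := a.comp (algebraMap ℚ K).injective) (by
      intro h
      exact hna fun n => by
        have h1 : a (algebraMap ℚ K n) ≤ 1 := h n
        simpa using h1)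
  obtain ⟨c, hc, hcE⟩ := AbsoluteValue.isEquiv_iff_exists_rpow_eq.1 hE
  have hn : ∀ n : ℕ, a n ^ c = n := fun n => by
    have h1 : a (algebraMap ℚ K n) ^ c = _ := congrFun hcE n
    simpa using h1
  have rpow_comm : ∀ {x : ℝ}, 0 ≤ x → ∀ s t : ℝ, (x ^ s) ^ t = (x ^ t) ^ s := fun hx s t => by
    rw [← Real.rpow_mul hx, ← Real.rpow_mul hx, mul_comm]
  have hmul : ∀ x y, (a (x * y)) ^ c = a x ^ c * a y ^ c := fun x y => by
    rw [map_mul, Real.mul_rpow (a.nonneg _) (a.nonneg _)]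
  have hinv : ∀ x : K, (a x ^ c) ^ c⁻¹ = a x := fun x => Real.rpow_rpow_inv (a.nonneg _) hc.ne'
  have hadd : ∀ x y, (a (x + y)) ^ c ≤ a x ^ c + a y ^ c := by
    intro x y
    set T := a x ^ c + a y ^ c with hT
    have hx0 : 0 ≤ a x ^ c := Real.rpow_nonneg (a.nonneg _) _
    have hy0 : 0 ≤ a y ^ c := Real.rpow_nonneg (a.nonneg _) _
    have hT0 : 0 ≤ T := add_nonneg hx0 hy0
    have key : ∀ m : ℕ, a (x + y) ^ m ≤ (m + 1) * (T ^ c⁻¹) ^ m := by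
      intro m
      rw [← map_pow, add_pow]
      refine (a.sum_le _ _).trans ((Finset.sum_le_card_nsmul _ _ ((T ^ c⁻¹) ^ m) ?_).trans_eq
        (by simp))
      intro i hi
      rw [← hinv, ← Real.rpow_natCast (T ^ c⁻¹), rpow_comm hT0, Real.rpow_natCast]
      refine Real.rpow_le_rpow (Real.rpow_nonneg (a.nonneg _) _) ?_ (inv_pos.2 hc).le
      have hp : ∀ (z : K) (j : ℕ), (a z ^ j) ^ c = (a z ^ c) ^ j := fun z j => by
        rw [← Real.rpow_natCast, ← Real.rpow_natCast, rpow_comm (a.nonneg _)]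
      rw [hmul, hmul, hn, map_pow, map_pow, hp, hp, hT, add_pow]
      exact Finset.single_le_sum (f := fun i => (a x ^ c) ^ i * (a y ^ c) ^ (m - i) *
        (m.choose i : ℝ)) (fun j _ => by positivity) hi
    have hle : a (x + y) ≤ T ^ c⁻¹ := by
      by_contra! hlt
      have hpos : 0 < a (x + y) := lt_of_le_of_lt (Real.rpow_nonneg hT0 _) hlt
      set r := T ^ c⁻¹ / a (x + y) with hr
      have hr0 : 0 ≤ r := div_nonneg (Real.rpow_nonneg hT0 _) hpos.le
      have hr1 : r < 1 := (div_lt_one hpos).2 hlt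
      have h1 : ∀ m : ℕ, 1 ≤ (m : ℝ) * r ^ m + r ^ m := fun m => by
        have := key m
        rw [hr, div_pow, ← add_one_mul, ← mul_div_assoc, le_div_iff₀ (by positivity), one_mul]
        exact this
      have h2 := (tendsto_self_mul_const_pow_of_lt_one hr0 hr1).add
        (tendsto_pow_atTop_nhds_zero_of_lt_one hr0 hr1)
      have := ge_of_tendsto' h2 h1
      norm_num at this
    calc _ ≤ (T ^ c⁻¹) ^ c := Real.rpow_le_rpow (a.nonneg _) hle hc.le
      _ = T := Real.rpow_inv_rpow hT0 hc.ne'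
  let f : AbsoluteValue K ℝ :=
    { toFun := fun x => a x ^ c
      map_mul' := hmul
      nonneg' := fun x => Real.rpow_nonneg (a.nonneg _) _
      eq_zero' := fun x => by
        rw [Real.rpow_eq_zero (a.nonneg _) hc.ne', a.eq_zero]
      add_le' := hadd }
  exact ⟨f, AbsoluteValue.isEquiv_iff_exists_rpow_eq.2 ⟨c, hc, rfl⟩, hn⟩

lemma norm_lt_one_iff_of_algEquiv {C D : Type*} [NormedField C] [NormedAlgebra ℝ C]
    [NormedField D] [NormedAlgebra ℝ D] [FiniteDimensional ℝ D] (e : C ≃ₐ[ℝ] D) (x : C) :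
    ‖x‖ < 1 ↔ ‖e x‖ < 1 := by
  have : FiniteDimensional ℝ C := e.symm.toLinearEquiv.finiteDimensional
  have h1 : Continuous e := e.toLinearMap.continuous_of_finiteDimensional
  have h2 : Continuous e.symm := e.symm.toLinearMap.continuous_of_finiteDimensional
  rw [← tendsto_pow_atTop_nhds_zero_iff_norm_lt_one, ← tendsto_pow_atTop_nhds_zero_iff_norm_lt_one]
  exact ⟨fun h => by simpa [Function.comp_def] using (h1.tendsto 0).comp h,
    fun h => by simpa [Function.comp_def] using (h2.tendsto 0).comp h⟩

lemma exists_extension_arch {K N : Type*} [Field K] [Field N] [Algebra K N]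
    [Algebra.IsAlgebraic K N] (f : AbsoluteValue K ℝ) (hf : ∀ n : ℕ, f n = n) :
    ∃ b : AbsoluteValue N ℝ, f.IsEquiv (b.comp (algebraMap K N).injective) := by
  let C := f.Completion
  have hnorm : ∀ x : K, ‖((WithAbs.toAbs f x : WithAbs f) : C)‖ = f x := fun x => by
    rw [UniformSpace.Completion.norm_coe]; rfl
  let j : K →+* C := UniformSpace.Completion.coeRingHom.comp
        ((WithAbs.equiv f).symm : K →+* WithAbs f)
  have hnat : ∀ n : ℕ, ‖(n : C)‖ = n := fun n => by
    rw [← map_natCast j n]; exact (hnorm n).trans (hf n)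
  have : CharZero C := charZero_of_inj_zero fun n hn => by
    have := hnat n
    rw [hn, norm_zero] at this
    exact_mod_cast this.symm
  have hrat : ∀ q : ℚ, ‖(q : C)‖ = ‖q‖ := fun q => by
    have hint : ∀ n : ℤ, ‖(n : C)‖ = |(n : ℝ)| := fun n => by
      rcases Int.eq_nat_or_neg n with ⟨m, rfl | rfl⟩ <;> simp [hnat]
    rw [Rat.cast_def, norm_div, hint, hnat]
    rw [← Rat.norm_cast_real, Real.norm_eq_abs, Rat.cast_def, abs_div, Nat.abs_cast]
  have hiso : Isometry (Rat.castHom C) :=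
    AddMonoidHomClass.isometry_of_norm _ hrat
  have hui : IsUniformInducing (Rat.castHom ℝ) := Rat.isUniformEmbedding_coe_real.isUniformInducing
  have hdr : DenseRange (Rat.castHom ℝ) := Rat.denseRange_cast
  let ι : ℝ →+* C := IsDenseInducing.extendRingHom hui hdr hiso.uniformContinuous
  have hιc : Continuous ι := (uniformContinuous_uniformly_extend hui hdr
    hiso.uniformContinuous).continuous
  have hι : ∀ r : ℝ, ‖ι r‖ = ‖r‖ := by
    intro r
    refine Rat.denseRange_cast.induction_on (p := fun r : ℝ => ‖ι r‖ = ‖r‖) r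
      (isClosed_eq (by fun_prop) (by fun_prop)) fun q => ?_
    rw [map_ratCast, hrat, Rat.norm_cast_real]
  let _ : Algebra ℝ C := ι.toAlgebra
  let _ : NormedAlgebra ℝ C := 
    { norm_smul_le := fun r x => by
        rw [Algebra.smul_def, norm_mul]
        exact (congrArg (· * ‖x‖) (hι r)).le }
  obtain ⟨φ, hφ⟩ : ∃ φ : C →+* ℂ, ∀ x, ‖x‖ < 1 ↔ ‖φ x‖ < 1 := by
    rcases NormedAlgebra.Real.nonempty_algEquiv_or C with ⟨⟨e⟩⟩ | ⟨⟨e⟩⟩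
    · exact ⟨(algebraMap ℝ ℂ).comp (e : C →+* ℝ), fun x =>
        (norm_lt_one_iff_of_algEquiv e x).trans (by simp)⟩
    · exact ⟨(e : C →+* ℂ), fun x => norm_lt_one_iff_of_algEquiv e x⟩
  let _ : Algebra K ℂ := (φ.comp j).toAlgebra
  let g : N →ₐ[K] ℂ := IsAlgClosed.lift
  let b : AbsoluteValue ℂ ℝ := NormedField.toAbsoluteValue ℂ
  refine ⟨b.comp (f := (g : N →+* ℂ)) (RingHom.injective _),
    AbsoluteValue.isEquiv_iff_lt_one_iff.2 fun x => ?_⟩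
  show f x < 1 ↔ ‖g (algebraMap K N x)‖ < 1
  rw [g.commutes, ← hnorm x]
  exact hφ _

/-- An absolute value extends to any algebraic extension, up to equivalence. -/
lemma exists_extension {K N : Type*} [Field K] [Field N] [Algebra K N]
    [Algebra.IsAlgebraic K N] (a : AbsoluteValue K ℝ) (ha : a.IsNontrivial) :
    ∃ b : AbsoluteValue N ℝ, a.IsEquiv (b.comp (algebraMap K N).injective) := by
  by_cases hna : ∀ n : ℕ, a n ≤ 1
  · obtain ⟨b, rfl⟩ := exists_extension_nonarch (N := N) a ha hna
    exact ⟨b, .rfl⟩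
  · obtain ⟨f, haf, hf⟩ := exists_rpow_of_arch a hna
    obtain ⟨b, hb⟩ := exists_extension_arch (N := N) f hf
    exact ⟨b, haf.trans hb⟩


/-- A place of a field: an equivalence class of nontrivial (real valued) absolute values. -/
def Place (K : Type*) [Field K] : Type _ :=
  Quotient (Setoid.comap Subtype.val
    (inferInstance : Setoid (AbsoluteValue K ℝ)) : Setoid {a : AbsoluteValue K ℝ // a.IsNontrivial})

namespace Place

/-- The place of a nontrivial absolute value. -/
def mk {K : Type*} [Field K] (a : AbsoluteValue K ℝ) (ha : a.IsNontrivial) : Place K :=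
  Quotient.mk _ ⟨a, ha⟩

lemma mk_eq_mk {K : Type*} [Field K] {a b : AbsoluteValue K ℝ} {ha : a.IsNontrivial}
    {hb : b.IsNontrivial} : mk a ha = mk b hb ↔ a.IsEquiv b :=
  ⟨fun h => Quotient.exact h, fun h => Quotient.sound h⟩

/-- A chosen absolute value in a place. -/
noncomputable def abv {K : Type*} [Field K] (v : Place K) : AbsoluteValue K ℝ :=
  (Quotient.out v).1

lemma abv_isNontrivial {K : Type*} [Field K] (v : Place K) : v.abv.IsNontrivial :=
  (Quotient.out v).2

lemma mk_abv {K : Type*} [Field K] (v : Place K) : mk v.abv v.abv_isNontrivial = v :=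
  Quotient.out_eq v

/-- The place of `K` obtained by pulling back along an integral (i.e. algebraic) field
homomorphism: the class of `x ↦ ‖f x‖` for any absolute value `‖ ‖` in the given class. -/
def comap {K L : Type*} [Field K] [Field L] (f : K →+* L) (hf : f.IsIntegral) :
    Place L → Place K :=
  Quotient.map (fun a => ⟨a.1.comp f.injective, absval_nontrivial_of_isIntegral f hf a.1 a.2⟩)
    (fun _ _ h x y => h (f x) (f y))

lemma comap_mk {K L : Type*} [Field K] [Field L] (f : K →+* L) (hf : f.IsIntegral)
    (a : AbsoluteValue L ℝ) (ha : a.IsNontrivial) :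
    comap f hf (mk a ha) =
      mk (a.comp f.injective) (absval_nontrivial_of_isIntegral f hf a ha) := rfl

lemma comap_comap {K L M : Type*} [Field K] [Field L] [Field M] (f : K →+* L)
    (hf : f.IsIntegral) (g : L →+* M) (hg : g.IsIntegral) (h : K →+* M) (hh : h.IsIntegral)
    (hfg : g.comp f = h) (w : Place M) : comap f hf (comap g hg w) = comap h hh w := by
  subst hfg
  induction w using Quotient.inductionOn
  rfl

/-- The place of `K` below a place of an algebraic extension `L`: `w ∣ v` means `w.under K = v`. -/
def under (K : Type*) {L : Type*} [Field K] [Field L] [Algebra K L] [Algebra.IsAlgebraic K L]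
    (w : Place L) : Place K :=
  comap (algebraMap K L) (Algebra.IsIntegral.isIntegral (R := K)) w

lemma under_under {K L M : Type*} [Field K] [Field L] [Field M] [Algebra K L] [Algebra L M]
    [Algebra K M] [IsScalarTower K L M] [Algebra.IsAlgebraic K L] [Algebra.IsAlgebraic L M]
    [Algebra.IsAlgebraic K M] (w : Place M) : (w.under L).under K = w.under K :=
  comap_comap _ _ _ _ _ _ (IsScalarTower.algebraMap_eq K L M).symm w

/-- Automorphisms act on places by `‖τ⁻¹ α‖_y = ‖α‖_{τ y}`. -/
instance galAction {K L : Type*} [Field K] [Field L] [Algebra K L] :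
    MulAction Gal(L/K) (Place L) where
  smul τ y := comap ((τ⁻¹ : Gal(L/K)) : L →+* L)
    (RingHom.isIntegral_of_surjective _ (τ⁻¹ : Gal(L/K)).surjective) y
  one_smul y := by
    induction y using Quotient.inductionOn
    rfl
  mul_smul σ τ y := by
    induction y using Quotient.inductionOn with | _ a
    refine Quotient.sound fun x y => ?_
    show a.1 ((σ * τ)⁻¹ x) ≤ a.1 ((σ * τ)⁻¹ y) ↔ a.1 (τ⁻¹ (σ⁻¹ x)) ≤ a.1 (τ⁻¹ (σ⁻¹ y))
    rw [mul_inv_rev]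
    rfl

lemma smul_def {K L : Type*} [Field K] [Field L] [Algebra K L] (τ : Gal(L/K)) (y : Place L) :
  τ • y = comap ((τ⁻¹ : Gal(L/K)) : L →+* L)
    (RingHom.isIntegral_of_surjective _ (τ⁻¹ : Gal(L/K)).surjective) y := rfl

lemma under_smul {K L : Type*} [Field K] [Field L] [Algebra K L] [Algebra.IsAlgebraic K L]
    (τ : Gal(L/K)) (y : Place L) : (τ • y).under K = y.under K :=
  comap_comap _ _ _ _ _ _ (by ext; simp) y

lemma continuous_withAbs_map {K L : Type*} [Field K] [Field L] (f : K →+* L)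
    (a : AbsoluteValue K ℝ) (b : AbsoluteValue L ℝ) (h : a.IsEquiv (b.comp f.injective)) :
    Continuous (WithAbs.map a b f) := by
  have h1 : Continuous (WithAbs.congr a (b.comp f.injective) (.refl K)) :=
    h.isEmbedding_equivWithAbs.continuous
  have h2 : Isometry (WithAbs.map (b.comp f.injective) b f) :=
    AddMonoidHomClass.isometry_of_norm _ fun x => rfl
  exact h2.continuous.comp h1

lemma exists_under_eq {K N : Type*} [Field K] [Field N] [Algebra K N] [Algebra.IsAlgebraic K N]
    (v : Place K) : ∃ y : Place N, y.under K = v := by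
  obtain ⟨b, hb⟩ := exists_extension (N := N) v.abv v.abv_isNontrivial
  obtain ⟨x, hx0, hx⟩ := hb.isNontrivial_congr.1 v.abv_isNontrivial
  refine ⟨mk b ⟨algebraMap K N x, by simpa using hx0, hx⟩, ?_⟩
  conv_rhs => rw [← mk_abv v]
  exact mk_eq_mk.2 hb.symm

/-- The completion `K_v` of `K` at the place `v`. -/
abbrev Completion {K : Type*} [Field K] (v : Place K) : Type _ := v.abv.Completion

lemma abv_isEquiv_comp {K L : Type*} [Field K] [Field L] [Algebra K L]
    [Algebra.IsAlgebraic K L] (w : Place L) :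
    (w.under K).abv.IsEquiv (w.abv.comp (algebraMap K L).injective) := by
  rw [← mk_eq_mk (ha := abv_isNontrivial _) (hb := absval_nontrivial_of_isIntegral _
    (Algebra.IsIntegral.isIntegral (R := K)) _ w.abv_isNontrivial), mk_abv]
  conv_lhs => rw [← mk_abv w]
  rfl

/-- The embedding `K_v → L_w`, where `v` is the place of `K` below `w`: the continuous extension
of `K → L`. -/
noncomputable def completionMap (K : Type*) {L : Type*} [Field K] [Field L] [Algebra K L]
    [Algebra.IsAlgebraic K L] (w : Place L) : (w.under K).Completion →+* w.Completion :=
  UniformSpace.Completion.mapRingHom (WithAbs.map (w.under K).abv w.abv (algebraMap K L))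
    (continuous_withAbs_map _ _ _ (abv_isEquiv_comp w))

/-- The local degree `[L_w : K_v]`, where `v` is the place of `K` below `w`. -/
noncomputable def localDegree (K : Type*) {L : Type*} [Field K] [Field L] [Algebra K L]
    [Algebra.IsAlgebraic K L] (w : Place L) : ℕ :=
  letI := (completionMap K w).toAlgebra
  Module.finrank (w.under K).Completion w.Completion

/-- A place `v` of `K` is well behaved if `∑_{w ∣ v} [L_w : K_v] = [L : K]` for all finite
extensions `L / K`. -/
def IsWellBehaved {K : Type u} [Field K] (v : Place K) : Prop :=
  ∀ (L : Type u) [Field L] [Algebra K L] [FiniteDimensional K L],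
    ∑ᶠ w : {w : Place L // w.under K = v}, localDegree K w.1 = Module.finrank K L

end Place

/-- A choice `a` of absolute values from the places in `M` is proper: the places in `M` are well
behaved, `‖x‖_v ≠ 1` for only finitely many `v` if `x ≠ 0`, and the product formula holds. -/
structure IsProper {K : Type u} [Field K] (M : Set (Place K))
    (a : M → AbsoluteValue K ℝ) : Prop where
  isNontrivial : ∀ v, (a v).IsNontrivial
  mk_eq : ∀ v, Place.mk (a v) (isNontrivial v) = v
  isWellBehaved : ∀ v ∈ M, v.IsWellBehaved
  finite : ∀ x : K, x ≠ 0 → {v | a v x ≠ 1}.Finite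
  prod_eq_one : ∀ x : K, x ≠ 0 → ∏ᶠ v, a v x = 1

/-! ### Transitivity -/

namespace Place

lemma abv_smul_isEquiv {K L : Type*} [Field K] [Field L] [Algebra K L] (σ : Gal(L/K))
    (w : Place L) :
    (σ • w).abv.IsEquiv (w.abv.comp (f := ((σ⁻¹ : Gal(L/K)) : L →+* L)) (RingHom.injective _)) := by
  rw [← mk_eq_mk (ha := abv_isNontrivial _) (hb := absval_nontrivial_of_isIntegral _
    (RingHom.isIntegral_of_surjective _ (σ⁻¹ : Gal(L/K)).surjective) _ w.abv_isNontrivial), mk_abv]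
  conv_lhs => rw [← mk_abv w]
  rfl

lemma exists_smul_eq_of_finite {K L : Type*} [Field K] [Field L] [Algebra K L]
    [FiniteDimensional K L] [IsGalois K L] (w w' : Place L) (h : w.under K = w'.under K) :
    ∃ σ : Gal(L/K), σ • w = w' := by
  classical
  by_contra! hne
  let S : Set (Place L) := Set.range (fun σ : Gal(L/K) => σ • w) ∪
    Set.range (fun σ : Gal(L/K) => σ • w')
  have hS : S.Finite := (Set.finite_range _).union (Set.finite_range _)
  have : Finite S := hS
  have hd := AbsoluteValue.denseRange_algebraMap_pi (F := L) (ι := S) (v := fun s => s.1.abv)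
    (fun s => s.1.abv_isNontrivial) (fun s t hst hE => hst (Subtype.ext (by
      rw [← mk_abv s.1, ← mk_abv t.1]; exact mk_eq_mk.2 hE)))
  have := Fintype.ofFinite S
  have hbig : ∀ s : Place L, ∃ b : L, 2 < s.abv b := fun s => by
    obtain ⟨x, hx⟩ := s.abv_isNontrivial.exists_abv_gt_one
    obtain ⟨m, hm⟩ := pow_unbounded_of_one_lt 2 hx
    exact ⟨x ^ m, by simpa using hm⟩
  choose b hb using hbig
  obtain ⟨x, hx⟩ := Metric.denseRange_iff.1 hd
    (fun s => WithAbs.toAbs _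
      (if s.1 ∈ Set.range (fun σ : Gal(L/K) => σ • w) then 0 else b s.1)) 1 one_pos
  have hx' : ∀ s : S, s.1.abv ((if s.1 ∈ Set.range (fun σ : Gal(L/K) => σ • w) then 0
      else b s.1) - x) < 1 := by
    intro s
    have := (dist_le_pi_dist _ _ s).trans_lt hx
    rw [dist_eq_norm] at this
    exact this
  have h1 : ∀ σ : Gal(L/K), w.abv (σ x) < 1 := fun σ => by
    have h := hx' ⟨σ⁻¹ • w, .inl ⟨_, rfl⟩⟩
    rw [if_pos ⟨_, rfl⟩, zero_sub, AbsoluteValue.map_neg,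
      (abv_smul_isEquiv σ⁻¹ w).lt_one_iff, inv_inv] at h
    exact h
  have h2 : ∀ σ : Gal(L/K), 1 < w'.abv (σ x) := fun σ => by
    have h := hx' ⟨σ⁻¹ • w', .inr ⟨_, rfl⟩⟩
    rw [if_neg] at h
    · have h3 : 1 < (σ⁻¹ • w').abv x := by
        have := (σ⁻¹ • w').abv.le_sub (b (σ⁻¹ • w')) x
        have := hb (σ⁻¹ • w')
        linarith
      rw [(abv_smul_isEquiv σ⁻¹ w').one_lt_iff, inv_inv] at h3
      exact h3
    · rintro ⟨τ, hτ⟩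
      refine hne (σ * τ) ?_
      rw [mul_smul]
      exact (eq_inv_smul_iff.1 hτ)
  have hn := Algebra.norm_eq_prod_automorphisms K x
  have h3 : w.abv (algebraMap K L (Algebra.norm K x)) < 1 := by
    rw [hn, map_prod]
    refine (Finset.prod_lt_prod_of_nonempty (g := fun _ => (1 : ℝ))
      (fun σ _ => w.abv.pos ?_) (fun σ _ => h1 σ) ⟨1, Finset.mem_univ _⟩).trans_eq (by simp)
    exact fun h0 => absurd (h2 σ) (by
      rw [(map_eq_zero_iff _ σ.injective).1 h0]; simp)
  have h4 : 1 < w'.abv (algebraMap K L (Algebra.norm K x)) := by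
    rw [hn, map_prod]
    refine Eq.trans_lt (by simp) (Finset.prod_lt_prod_of_nonempty (f := fun _ => (1 : ℝ))
      (fun σ _ => one_pos) (fun σ _ => h2 σ) ⟨1, Finset.mem_univ _⟩)
  have h5 := ((abv_isEquiv_comp (K := K) w).lt_one_iff (x := Algebra.norm K x)).2 h3
  have h6 := ((abv_isEquiv_comp (K := K) w').one_lt_iff (x := Algebra.norm K x)).2 h4
  rw [h] at h5
  exact absurd h5 h6.le.not_gt

/-- The place of `L` below a place `y` of `N`. -/
noncomputable def psi {K N : Type*} [Field K] [Field N] [Algebra K N] [IsGalois K N]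
    (L : FiniteGaloisIntermediateField K N) (y : Place N) : Place L :=
  y.under L

lemma psi_smul {K N : Type*} [Field K] [Field N] [Algebra K N] [IsGalois K N]
    (L : FiniteGaloisIntermediateField K N) (τ : Gal(N/K)) (y : Place N) :
    psi L (τ • y) = (AlgEquiv.restrictNormalHom L τ) • psi L y := by
  have hL : (algebraMap L N).IsIntegral := Algebra.IsIntegral.isIntegral (R := L)
  have h1 : psi L (τ • y) = comap _ (RingHom.IsIntegral.trans _ _ hL
    (RingHom.isIntegral_of_surjective _ (τ⁻¹ : Gal(N/K)).surjective)) y :=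
    comap_comap _ hL _ _ _ _ rfl y
  rw [h1, smul_def]
  refine (comap_comap _ _ _ hL _ _ ?_ y).symm
  ext x
  show algebraMap L N ((AlgEquiv.restrictNormalHom L τ)⁻¹ x) = τ⁻¹ (algebraMap L N x)
  rw [← map_inv]
  exact AlgEquiv.restrictNormal_commutes τ⁻¹ L x

lemma eq_of_psi_eq {K N : Type*} [Field K] [Field N] [Algebra K N] [IsGalois K N]
    {y z : Place N} (h : ∀ L : FiniteGaloisIntermediateField K N, psi L y = psi L z) : y = z := by
  induction y using Quotient.inductionOn with | _ a
  induction z using Quotient.inductionOn with | _ b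
  refine Quotient.sound fun x x' => ?_
  let L := FiniteGaloisIntermediateField.adjoin K ({x, x'} : Set N)
  have hL := FiniteGaloisIntermediateField.subset_adjoin K ({x, x'} : Set N)
  exact mk_eq_mk.1 (h L) ⟨x, hL (by simp)⟩ ⟨x', hL (by simp)⟩

lemma continuous_restrict {K N : Type*} [Field K] [Field N] [Algebra K N] [IsGalois K N]
    (L : FiniteGaloisIntermediateField K N) : IsLocallyConstant
    (AlgEquiv.restrictNormalHom L : Gal(N/K) →* Gal(L/K)) :=
  (IsLocallyConstant.iff_continuous _).2 (InfiniteGalois.restrictNormalHom_continuous L.1)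

lemma isLocallyConstant_psi_smul {K N : Type*} [Field K] [Field N] [Algebra K N] [IsGalois K N]
    (L : FiniteGaloisIntermediateField K N) (y : Place N) :
    IsLocallyConstant (fun τ : Gal(N/K) => psi L (τ • y)) := by
  simp_rw [psi_smul]
  exact (continuous_restrict L).comp (fun σ => σ • psi L y)

lemma psi_under {K N : Type*} [Field K] [Field N] [Algebra K N] [IsGalois K N]
    (L : FiniteGaloisIntermediateField K N) (y : Place N) : (psi L y).under K = y.under K :=
  under_under y

lemma psi_eq_of_le {K N : Type*} [Field K] [Field N] [Algebra K N] [IsGalois K N]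
    {L M : FiniteGaloisIntermediateField K N} (h : L ≤ M) {y z : Place N}
    (hM : psi M y = psi M z) : psi L y = psi L z := by
  let f : L →+* M := (IntermediateField.inclusion h).toRingHom
  have hf : f.IsIntegral := RingHom.IsIntegral.tower_top (algebraMap K L) f
    (Algebra.IsIntegral.isIntegral (R := K) (A := M))
  have key : ∀ y : Place N, comap f hf (psi M y) = psi L y := fun y =>
    comap_comap _ _ _ (Algebra.IsIntegral.isIntegral (R := M)) _
      (Algebra.IsIntegral.isIntegral (R := L)) rfl y
  rw [← key, ← key, hM]

/-- The Galois group acts transitively on the places above a given place. -/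
lemma exists_smul_eq {K N : Type*} [Field K] [Field N] [Algebra K N] [IsGalois K N]
    (y z : Place N) (h : y.under K = z.under K) : ∃ τ : Gal(N/K), τ • y = z := by
  have hne : (⋂ L : FiniteGaloisIntermediateField K N,
      {τ : Gal(N/K) | psi L (τ • y) = psi L z}).Nonempty := by
    refine IsCompact.nonempty_iInter_of_directed_nonempty_isCompact_isClosed _ ?_ ?_ ?_ ?_
    · intro L M
      exact ⟨L ⊔ M, fun τ hτ => psi_eq_of_le le_sup_left hτ,
        fun τ hτ => psi_eq_of_le le_sup_right hτ⟩
    · intro L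
      obtain ⟨σ, hσ⟩ := exists_smul_eq_of_finite (K := K) (psi L y) (psi L z)
        (by rw [psi_under, psi_under, h])
      obtain ⟨τ, rfl⟩ := AlgEquiv.restrictNormalHom_surjective (F := K) (K₁ := L) N σ
      exact ⟨τ, by rw [Set.mem_ofPred_eq, psi_smul, hσ]⟩
    · intro L
      exact ((isLocallyConstant_psi_smul L y).isClosed_fiber _).isCompact
    · intro L
      exact (isLocallyConstant_psi_smul L y).isClosed_fiber _
  obtain ⟨τ, hτ⟩ := hne
  exact ⟨τ, eq_of_psi_eq fun L => Set.mem_iInter.1 hτ L⟩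

end Place

/-- The set `Y` of all places of `N` lying over a place in `M`. -/
def PlacesOver {K : Type*} (N : Type*) [Field K] [Field N] [Algebra K N] [IsGalois K N]
    (M : Set (Place K)) : Type _ :=
  {y : Place N // y.under K ∈ M}

namespace PlacesOver
variable {K N : Type*} [Field K] [Field N] [Algebra K N] [IsGalois K N] {M : Set (Place K)}

/-- The map `ψ_L`, sending a place `y` in `Y` to the place of `L` below it. -/
noncomputable def psi (L : FiniteGaloisIntermediateField K N) (y : PlacesOver N M) : Place L :=
  Place.psi L y.1

/-- The topology of `Y`, with the sets `ψ_L⁻¹(w)` as basis. -/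
instance : TopologicalSpace (PlacesOver N M) :=
  TopologicalSpace.generateFrom
    {S | ∃ (L : FiniteGaloisIntermediateField K N) (w : Place L), S = psi L ⁻¹' {w}}

instance : MeasurableSpace (PlacesOver N M) := borel _

instance : BorelSpace (PlacesOver N M) := ⟨rfl⟩

instance : MulAction Gal(N/K) (PlacesOver N M) where
  smul τ y := ⟨τ • y.1, by rw [Place.under_smul]; exact y.2⟩
  one_smul y := Subtype.ext (one_smul _ y.1)
  mul_smul σ τ y := Subtype.ext (mul_smul σ τ y.1)

lemma isOpen_psi (L : FiniteGaloisIntermediateField K N) (w : Place L) :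
    IsOpen (psi (M := M) L ⁻¹' {w}) :=
  TopologicalSpace.isOpen_generateFrom_of_mem ⟨L, w, rfl⟩

lemma isOpen_psi_preimage (L : FiniteGaloisIntermediateField K N) (S : Set (Place L)) :
    IsOpen (psi (M := M) L ⁻¹' S) := by
  rw [← Set.biUnion_preimage_singleton]
  exact isOpen_biUnion fun w _ => isOpen_psi L w

instance : T2Space (PlacesOver N M) := by
  refine ⟨fun y z hyz => ?_⟩
  obtain ⟨L, hL⟩ : ∃ L : FiniteGaloisIntermediateField K N, psi L y ≠ psi L z := by
    by_contra! h
    exact hyz (Subtype.ext (Place.eq_of_psi_eq h))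
  exact ⟨_, _, isOpen_psi L (psi L y), isOpen_psi L (psi L z), rfl, rfl,
    Disjoint.preimage _ (by simpa using hL)⟩

lemma continuous_smul (y : PlacesOver N M) : Continuous fun τ : Gal(N/K) => τ • y := by
  refine continuous_generateFrom_iff.2 ?_
  rintro _ ⟨L, w, rfl⟩
  exact (Place.isLocallyConstant_psi_smul L y.1).isOpen_fiber w

/-- The subset `Y(K, v)` of `Y`. -/
def fiber (N : Type*) [Field N] [Algebra K N] [IsGalois K N] {M : Set (Place K)} (v : Place K) :
    Set (PlacesOver N M) := {y | y.1.under K = v}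

lemma isOpen_fiber (v : Place K) : IsOpen (fiber N v : Set (PlacesOver N M)) := by
  convert isOpen_psi_preimage (M := M) (N := N) ⊥ {w | w.under K = v} using 1
  ext y
  show y.1.under K = v ↔ (Place.psi ⊥ y.1).under K = v
  rw [Place.psi_under]

lemma isCompact_fiber (v : Place K) : IsCompact (fiber N v : Set (PlacesOver N M)) := by
  rcases (fiber N v : Set (PlacesOver N M)).eq_empty_or_nonempty with h | ⟨y, hy⟩
  · rw [h]; exact isCompact_empty
  convert isCompact_range (continuous_smul y)
  ext z
  constructor
  · intro hz
    obtain ⟨τ, hτ⟩ := Place.exists_smul_eq (K := K) y.1 z.1 (Eq.trans hy hz.symm)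
    exact ⟨τ, Subtype.ext hτ⟩
  · rintro ⟨τ, rfl⟩
    exact (Place.under_smul τ y.1).trans hy

instance : LocallyCompactSpace (PlacesOver N M) := by
  have : WeaklyLocallyCompactSpace (PlacesOver N M) :=
    ⟨fun y => ⟨_, isCompact_fiber (y.1.under K), (isOpen_fiber _).mem_nhds rfl⟩⟩
  infer_instance

end PlacesOver

namespace PlacesOver

variable {K N : Type*} [Field K] [Field N] [Algebra K N] [IsGalois K N] {M : Set (Place K)}

instance : MeasurableSpace Gal(N/K) := borel _

instance : BorelSpace Gal(N/K) := ⟨rfl⟩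

/-- The Haar measure `μ` on `Gal(N/K)` with `μ(Gal(N/K)) = 1`. -/
noncomputable def galHaar (K N : Type*) [Field K] [Field N] [Algebra K N] [IsGalois K N] :
    Measure Gal(N/K) :=
  Measure.haarMeasure ⊤

lemma isFiniteMeasure_galHaar : IsFiniteMeasure (galHaar K N) :=
  ⟨by
    have h : galHaar K N Set.univ = 1 :=
      Measure.haarMeasure_self (K₀ := (⊤ : TopologicalSpace.PositiveCompacts Gal(N/K)))
    rw [h]; exact ENNReal.one_lt_top⟩

/-- A point `z_v` in `Y(K, v)`, for each `v` in `M`. -/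
noncomputable def basePoint (N : Type*) [Field N] [Algebra K N] [IsGalois K N]
    (M : Set (Place K)) (v : M) : PlacesOver N M :=
  ⟨(Place.exists_under_eq (N := N) v.1).choose, by
    rw [(Place.exists_under_eq (N := N) v.1).choose_spec]; exact v.2⟩

lemma basePoint_mem (v : M) : basePoint N M v ∈ (fiber N v.1 : Set (PlacesOver N M)) :=
  (Place.exists_under_eq (N := N) v.1).choose_spec

/-- `I_v(F) = ∫_G F(τ z_v) dμ(τ)`, with `G = Gal(N/K)`. -/
noncomputable def localIntegral (v : M) (F : C_c(PlacesOver N M, ℝ)) : ℝ :=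
  ∫ τ : Gal(N/K), F (τ • basePoint N M v) ∂(galHaar K N)

lemma integrable_orbit (v : M) (F : C_c(PlacesOver N M, ℝ)) :
    Integrable (fun τ : Gal(N/K) => F (τ • basePoint N M v)) (galHaar K N) := by
  have := isFiniteMeasure_galHaar (K := K) (N := N)
  exact (F.continuous.comp (continuous_smul _)).integrable_of_hasCompactSupport
    (HasCompactSupport.of_compactSpace _)

lemma finite_support_localIntegral (F : C_c(PlacesOver N M, ℝ)) :
    (Function.support fun v : M => localIntegral v F).Finite := by
  obtain ⟨t, ht⟩ := F.hasCompactSupport.isCompact.elim_finite_subcover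
    (fun v : M => (fiber N v.1 : Set (PlacesOver N M))) (fun v => isOpen_fiber v.1)
    (fun y _ => Set.mem_iUnion.2 ⟨⟨y.1.under K, y.2⟩, rfl⟩)
  refine t.finite_toSet.subset fun v hv => ?_
  by_contra hvt
  refine hv (integral_eq_zero_of_ae (.of_forall fun τ => ?_))
  by_contra hne
  obtain ⟨u, hu, hmem⟩ := Set.mem_iUnion₂.1 (ht (subset_tsupport _ hne))
  have h1 : (τ • (basePoint N M v).1).under K = u.1 := hmem
  rw [Place.under_smul, show (basePoint N M v).1.under K = v.1 from basePoint_mem v] at h1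
  exact hvt (Subtype.ext h1 ▸ hu)

/-- The positive linear functional `I(F) = ∑_{v ∈ M} I_v(F)` on `C_c(Y)`; the sum is finite. -/
noncomputable def functional (N : Type*) [Field N] [Algebra K N] [IsGalois K N]
    (M : Set (Place K)) : C_c(PlacesOver N M, ℝ) →ₚ[ℝ] ℝ :=
  PositiveLinearMap.mk₀
    { toFun := fun F => ∑ᶠ v : M, localIntegral v F
      map_add' := fun F F' => by
        rw [← finsum_add_distrib (finite_support_localIntegral F) (finite_support_localIntegral F')]
        exact finsum_congr fun v =>
          integral_add (integrable_orbit v F) (integrable_orbit v F')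
      map_smul' := fun c F => by
        rw [RingHom.id_apply, smul_finsum]
        exact finsum_congr fun v => integral_smul c _ }
    (fun F hF => finsum_nonneg fun v => integral_nonneg fun τ => hF _)

/-- The invariant measure `λ` on the Borel sets of `Y`: the unique regular measure with
`∫ F dλ = I(F)` for all `F` in `C_c(Y)`. -/
noncomputable def invariantMeasure (N : Type*) [Field N] [Algebra K N] [IsGalois K N]
    (M : Set (Place K)) : Measure (PlacesOver N M) :=
  RealRMK.rieszMeasure (functional N M)

end PlacesOver

/-- The quotient `[L_w : K_v] / [L : K]`, where `v` is the place of `K` below `w`. -/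
noncomputable def localDegreeQuotient {K N : Type*} [Field K] [Field N] [Algebra K N]
    (L : FiniteGaloisIntermediateField K N) (w : Place L) : ℝ≥0∞ :=
  (w.localDegree K : ℝ≥0∞) / (Module.finrank K L : ℝ≥0∞)

/-! The set `ψ_L⁻¹(w)` is compact and open, so its indicator function lies in `C_c(Y)`, and the
formula defining `λ` gives its measure as the sum over `u` in `M` of `μ {τ | τ z_u ∈ ψ_L⁻¹(w)}`.
Since `G` preserves the place of `K` below, only the place `v` below `w` contributes.

For this `v`, `ψ_L(τ z_v) = τ|_L • ψ_L(z_v)`, so the condition on `τ` depends only on its image in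
the finite group `Gal(L/K)`. That group acts transitively on the places over `v`, hence the
admissible images form a coset of a conjugate of the decomposition group, of the same order as the
stabilizer of `w`. Haar measure induces the uniform measure on the finite quotient, so the result is
`|Stab(w)| / [L : K]` (`measureReal_smul_eq`), whatever `z_v` was chosen.

It remains to see that `|Stab(w)| = [L_w : K_v]` (`Place.localDegree_eq_card_stabilizer`). The
completion `L_w` is the compositum of `K_v` and `L`, hence Galois over `K_v`. Restriction to `L`
embeds `Gal(L_w/K_v)` in `Gal(L/K)`, and its image is the stabilizer of `w`: automorphisms of `L_w`
over `K_v` are continuous, and an automorphism of `L` that fixes `w` extends to the completion. -/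

open scoped TensorProduct in
/-- If `L` is finite over `K` and dense in an algebra `D` over a complete field `C`, then `D` is
the compositum of `C` and `L`. -/
lemma surjective_lift_of_denseRange (K L C D : Type*) [Field K] [Field L]
    [NontriviallyNormedField C] [CompleteSpace C] [Field D] [TopologicalSpace D]
    [IsTopologicalRing D] [T2Space D] [Algebra K L] [Algebra K C] [Algebra K D] [Algebra L D]
    [Algebra C D] [IsScalarTower K L D] [IsScalarTower K C D] [ContinuousSMul C D]
    [FiniteDimensional K L] (hd : DenseRange (algebraMap L D)) :
    Function.Surjective (Algebra.TensorProduct.lift (Algebra.ofId C D)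
      (IsScalarTower.toAlgHom K L D) fun _ _ => Commute.all _ _) := by
  set f := Algebra.TensorProduct.lift (Algebra.ofId C D)
      (IsScalarTower.toAlgHom K L D) fun _ _ => Commute.all _ _
  -- The range is the image of `C ⊗[K] L`, hence finite-dimensional over the complete field `C` and
  -- therefore closed; it also contains the dense image of `L`.
  have hc : IsClosed (LinearMap.range f.toLinearMap : Set D) :=
    Submodule.closed_of_finiteDimensional _
  have hsub : Set.range (algebraMap L D) ⊆ (LinearMap.range f.toLinearMap : Set D) := by
    rintro _ ⟨x, rfl⟩
    exact ⟨1 ⊗ₜ x, by simp [f]⟩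
  intro y
  have hy : y ∈ (LinearMap.range f.toLinearMap : Set D) :=
    closure_minimal hsub hc (hd.closure_range ▸ Set.mem_univ y)
  exact hy

/-- If `L / K` is finite Galois and `L` is dense in an algebra `D` over a complete field
`C ⊇ K`, then `D / C` is finite Galois. -/
lemma isGalois_of_denseRange (K L C D : Type*) [Field K] [Field L]
    [NontriviallyNormedField C] [CompleteSpace C] [Field D] [TopologicalSpace D]
    [IsTopologicalRing D] [T2Space D] [Algebra K L] [Algebra K C] [Algebra K D] [Algebra L D]
    [Algebra C D] [IsScalarTower K L D] [IsScalarTower K C D] [ContinuousSMul C D]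
    [FiniteDimensional K L] [IsGalois K L] (hd : DenseRange (algebraMap L D)) :
    FiniteDimensional C D ∧ IsGalois C D := by
  have hs := surjective_lift_of_denseRange K L C D hd
  refine ⟨Module.Finite.of_surjective _ hs, ?_⟩
  obtain ⟨p, hp, hsplit⟩ := IsGalois.is_separable_splitting_field K L
  -- A separable polynomial with splitting field `L` over `K` has splitting field `D` over `C`: it
  -- splits already in `L`, and its roots generate `L` over `K`, hence `D = C·L` over `C`.
  have hsp : (p.map (algebraMap K C)).IsSplittingField C D := by
    refine ⟨?_, ?_⟩
    · rw [Polynomial.map_map, ← IsScalarTower.algebraMap_eq, IsScalarTower.algebraMap_eq K L D,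
        ← Polynomial.map_map]
      exact hsplit.splits'.map _
    · refine Algebra.eq_top_iff.2 fun y => ?_
      obtain ⟨t, rfl⟩ := hs y
      induction t using TensorProduct.induction_on with
      | zero => rw [map_zero]; exact zero_mem _
      | add s t hs ht => rw [map_add]; exact add_mem hs ht
      | tmul c x =>
        rw [Algebra.TensorProduct.lift_tmul]
        refine mul_mem (Subalgebra.algebraMap_mem _ c) ?_
        have hx : x ∈ Algebra.adjoin K (p.rootSet L) := by
          rw [hsplit.adjoin_rootSet']; trivial
        show algebraMap L D x ∈ _
        induction hx using Algebra.adjoin_induction with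
        | mem x hx =>
          refine Algebra.subset_adjoin ?_
          rw [Polynomial.mem_rootSet'] at hx ⊢
          refine ⟨?_, ?_⟩
          · rw [Polynomial.map_map]
            exact (Polynomial.map_ne_zero_iff (RingHom.injective _)).2 hp.ne_zero
          · rw [Polynomial.aeval_map_algebraMap, Polynomial.aeval_algebraMap_apply, hx.2, map_zero]
        | algebraMap r =>
          rw [← IsScalarTower.algebraMap_apply, IsScalarTower.algebraMap_apply K C D]
          exact Subalgebra.algebraMap_mem _ _
        | add x y _ _ hx hy => rw [map_add]; exact add_mem hx hy
        | mul x y _ _ hx hy => rw [map_mul]; exact mul_mem hx hy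
  exact IsGalois.of_separable_splitting_field (p := p.map (algebraMap K C)) hp.map

/-- The restriction map `Gal(D/C) → Gal(L/K)` is injective if `L` is dense in `D`. -/
lemma injective_restrictNormalHom_of_denseRange (K L C D : Type*) [Field K] [Field L]
    [NontriviallyNormedField C] [CompleteSpace C] [Field D] [TopologicalSpace D]
    [IsTopologicalRing D] [T2Space D] [Algebra K L] [Algebra K C] [Algebra K D] [Algebra L D]
    [Algebra C D] [IsScalarTower K L D] [IsScalarTower K C D] [ContinuousSMul C D]
    [FiniteDimensional K L] [IsGalois K L] (hd : DenseRange (algebraMap L D)) :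
    Function.Injective fun σ : Gal(D/C) =>
      AlgEquiv.restrictNormalHom L (σ.restrictScalars K) := by
  intro σ τ h
  -- Equal restrictions mean agreement on the image of `L`. Both maps fix `C`, and `C` and `L`
  -- together generate `D`.
  have hx : ∀ x : L, σ (algebraMap L D x) = τ (algebraMap L D x) := fun x => by
    have h1 := AlgEquiv.restrictNormal_commutes (σ.restrictScalars K) L x
    have h2 := AlgEquiv.restrictNormal_commutes (τ.restrictScalars K) L x
    have h3 : (σ.restrictScalars K).restrictNormal L = (τ.restrictScalars K).restrictNormal L := h
    rw [h3] at h1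
    exact h1.symm.trans h2
  ext y
  obtain ⟨t, rfl⟩ := surjective_lift_of_denseRange K L C D hd y
  induction t using TensorProduct.induction_on with
  | zero => simp
  | add s t hs ht => simp only [map_add, hs, ht]
  | tmul c x =>
    rw [Algebra.TensorProduct.lift_tmul, map_mul, map_mul]
    exact congrArg₂ _ ((σ.commutes c).trans (τ.commutes c).symm) (hx x)

/-! ### Decomposition groups and local degrees -/

namespace Place

section
variable {K L : Type*} [Field K] [Field L] [Algebra K L]

/-- The action on places involves `σ⁻¹`, so passing to the inverse, which does not affect membership
in a subgroup, removes it. In this form the stabilizer consists of the automorphisms that respect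
the topology of `w`. -/
lemma mem_stabilizer_iff (σ : Gal(L/K)) (w : Place L) :
    σ ∈ MulAction.stabilizer Gal(L/K) w ↔ w.abv.IsEquiv (w.abv.comp (f := (σ : L →+* L))
      (RingHom.injective _)) := by
  rw [← inv_mem_iff, MulAction.mem_stabilizer_iff]
  have h := abv_smul_isEquiv σ⁻¹ w
  simp only [inv_inv] at h
  constructor
  · intro hw
    rw [hw] at h
    exact h
  · intro hw
    rw [← mk_abv (σ⁻¹ • w), ← mk_abv w]
    refine mk_eq_mk.2 ?_
    rw [mk_abv w]
    exact h.trans hw.symm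

/-- The embedding of a field in its completion at a place. -/
noncomputable def toCompletion (w : Place L) : L →+* w.Completion :=
  UniformSpace.Completion.coeRingHom.comp ((WithAbs.equiv w.abv).symm : L →+* WithAbs w.abv)

lemma norm_toCompletion (w : Place L) (x : L) : ‖w.toCompletion x‖ = w.abv x := by
  show ‖((WithAbs.toAbs w.abv x : WithAbs w.abv) : w.Completion)‖ = _
  rw [UniformSpace.Completion.norm_coe]; rfl

lemma denseRange_toCompletion (w : Place L) : DenseRange w.toCompletion :=
  (UniformSpace.Completion.denseRange_coe (α := WithAbs w.abv)).comp
    (WithAbs.equiv w.abv).symm.surjective.denseRange (UniformSpace.Completion.continuous_coe _)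

lemma completionMap_toCompletion [Algebra.IsAlgebraic K L] (w : Place L) (x : K) :
    completionMap K w ((w.under K).toCompletion x) = w.toCompletion (algebraMap K L x) :=
  UniformSpace.Completion.mapRingHom_coe _ _

lemma continuous_completionMap [Algebra.IsAlgebraic K L] (w : Place L) :
    Continuous (completionMap K w) :=
  UniformSpace.Completion.continuous_map

/-- A ring endomorphism of `L` respecting the place `w` extends to the completion. -/
noncomputable def completionEndo (w : Place L) (σ : L →+* L)
    (h : w.abv.IsEquiv (w.abv.comp σ.injective)) : w.Completion →+* w.Completion :=
  UniformSpace.Completion.mapRingHom (WithAbs.map w.abv w.abv σ) (continuous_withAbs_map _ _ _ h)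

lemma completionEndo_toCompletion (w : Place L) (σ : L →+* L)
    (h : w.abv.IsEquiv (w.abv.comp σ.injective)) (x : L) :
    completionEndo w σ h (w.toCompletion x) = w.toCompletion (σ x) :=
  UniformSpace.Completion.mapRingHom_coe _ _

lemma continuous_completionEndo (w : Place L) (σ : L →+* L)
    (h : w.abv.IsEquiv (w.abv.comp σ.injective)) : Continuous (completionEndo w σ h) :=
  UniformSpace.Completion.continuous_map

/-- The local degree of a finite Galois extension is the order of the decomposition group. -/
lemma localDegree_eq_card_stabilizer [FiniteDimensional K L] [IsGalois K L] (w : Place L) :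
    localDegree K w = Nat.card (MulAction.stabilizer Gal(L/K) w) := by
  let C := (w.under K).Completion
  let D := w.Completion
  -- A nontrivial norm is what makes finite-dimensional subspaces closed and linear maps between
  -- finite-dimensional spaces continuous.
  let _ : NontriviallyNormedField C :=
    { (inferInstance : NormedField C) with
      non_trivial := by
        obtain ⟨x, hx⟩ := (w.under K).abv_isNontrivial.exists_abv_gt_one
        exact ⟨(w.under K).toCompletion x, by
          refine lt_of_lt_of_eq hx (norm_toCompletion _ x).symm⟩ }
  let _ : Algebra C D := (completionMap K w).toAlgebra
  have : IsScalarTower K L D := IsScalarTower.of_algebraMap_eq fun _ => rfl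
  have : IsScalarTower K C D := IsScalarTower.of_algebraMap_eq fun x =>
    (completionMap_toCompletion w x).symm
  have : ContinuousSMul C D := ⟨by
    simp_rw [Algebra.smul_def]
    exact ((continuous_completionMap w).comp continuous_fst).mul continuous_snd⟩
  have hd : DenseRange (algebraMap L D) := denseRange_toCompletion w
  obtain ⟨hfin, hgal⟩ := isGalois_of_denseRange K L C D hd
  show Module.finrank C D = _
  -- The degree is the order of `Gal(D/C)`, hence of its image in `Gal(L/K)`; the image is now
  -- identified with the stabilizer.
  rw [← IsGalois.card_aut_eq_finrank C D, ← Nat.card_range_of_injective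
    (injective_restrictNormalHom_of_denseRange K L C D hd)]
  refine Nat.card_congr (Equiv.setCongr (Set.ext fun σ => ?_))
  rw [SetLike.mem_coe, mem_stabilizer_iff, Set.mem_range]
  constructor
  · rintro ⟨τ, rfl⟩
    have hτ : ∀ x : L, w.toCompletion (AlgEquiv.restrictNormalHom L (τ.restrictScalars K) x) =
        τ (w.toCompletion x) := fun x =>
      AlgEquiv.restrictNormal_commutes (τ.restrictScalars K) L x
    have h1 : Continuous τ := τ.toLinearMap.continuous_of_finiteDimensional
    have h2 : Continuous τ.symm := τ.symm.toLinearMap.continuous_of_finiteDimensional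
    -- Equivalence is decided by the open unit ball, and `‖x‖ < 1` means `x ^ n → 0`, a condition
    -- preserved by the homeomorphism `τ`.
    refine AbsoluteValue.isEquiv_iff_lt_one_iff.2 fun x => ?_
    show w.abv x < 1 ↔ w.abv (AlgEquiv.restrictNormalHom L (τ.restrictScalars K) x) < 1
    rw [← norm_toCompletion, ← norm_toCompletion, hτ, ← tendsto_pow_atTop_nhds_zero_iff_norm_lt_one,
      ← tendsto_pow_atTop_nhds_zero_iff_norm_lt_one]
    exact ⟨fun h => by simpa [Function.comp_def] using (h1.tendsto 0).comp h,
      fun h => by simpa [Function.comp_def] using (h2.tendsto 0).comp h⟩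
  · intro hσ
    let φ : D →ₐ[C] D :=
      { completionEndo w (σ : L →+* L) hσ with
        commutes' := fun c => by
          show completionEndo w (σ : L →+* L) hσ (completionMap K w c) = completionMap K w c
          -- Both sides are continuous in `c` and agree on the dense subfield `K`, which `σ` fixes.
          refine (denseRange_toCompletion (w.under K)).induction_on c (isClosed_eq
            ((continuous_completionEndo _ _ _).comp (continuous_completionMap w))
            (continuous_completionMap w)) fun x => ?_
          rw [completionMap_toCompletion, completionEndo_toCompletion]
          exact congrArg _ (σ.commutes x) }
    -- An endomorphism of the finite extension `D / C` is automatically bijective.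
    refine ⟨AlgEquiv.ofBijective φ φ.bijective, ?_⟩
    ext x
    refine w.toCompletion.injective ?_
    exact (AlgEquiv.restrictNormal_commutes _ L x).trans (completionEndo_toCompletion w _ hσ x)

end
end Place

/-! ### The measure of compact open sets -/

namespace PlacesOver
variable {K N : Type*} [Field K] [Field N] [Algebra K N] [IsGalois K N] {M : Set (Place K)}

/-- The complement is again a union of fibers of `ψ_L`, and these are open. -/
lemma isClopen_psi (L : FiniteGaloisIntermediateField K N) (w : Place L) :
    IsClopen (psi (M := M) L ⁻¹' {w}) :=
  ⟨⟨by rw [← Set.preimage_compl]; exact isOpen_psi_preimage L _⟩, isOpen_psi L w⟩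

/-- All points of the set lie over one place of `K`, so it is a closed subset of a compact `Y(K,
v)`. -/
lemma isCompact_psi (L : FiniteGaloisIntermediateField K N) (w : Place L) :
    IsCompact (psi (M := M) L ⁻¹' {w}) := by
  refine (isCompact_fiber (w.under K)).of_isClosed_subset (isClopen_psi L w).1 ?_
  rintro y rfl
  exact (Place.psi_under L y.1).symm

/-- The measure of a compact open set is the sum of the measures of its orbit preimages. -/
lemma invariantMeasure_of_isClopen {S : Set (PlacesOver N M)} (hS : IsClopen S)
    (hc : IsCompact S) : (invariantMeasure N M).real S =
      ∑ᶠ v : M, (galHaar K N).real {τ | τ • basePoint N M v ∈ S} := by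
  let F : C_c(PlacesOver N M, ℝ) :=
    { toFun := S.indicator 1
      continuous_toFun := hS.continuous_indicator continuous_one
      hasCompactSupport' := HasCompactSupport.intro hc fun x hx => Set.indicator_of_notMem hx _ }
  have hF : ∀ y, F y = S.indicator 1 y := fun y => rfl
  have h := RealRMK.integral_rieszMeasure (functional N M) F
  simp only [hF] at h
  rw [integral_indicator_one hS.2.measurableSet] at h
  refine h.trans (finsum_congr fun v => ?_)
  have hm : MeasurableSet {τ : Gal(N/K) | τ • basePoint N M v ∈ S} :=
    (hS.2.preimage (continuous_smul _)).measurableSet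
  rw [← integral_indicator_one hm]
  rfl

end PlacesOver

open scoped Classical in
/-- The Haar measure of the set of `τ` whose image in a finite quotient moves `x` to `y`. -/
lemma measureReal_smul_eq {G H X : Type*} [Group G] [MeasurableSpace G]
    [MeasurableMul G] (μ : Measure G) [IsProbabilityMeasure μ] [μ.IsMulLeftInvariant]
    [Group H] [Finite H] [MulAction H X] (f : G →* H) (hf : Function.Surjective f)
    (hm : ∀ s : Set H, MeasurableSet (f ⁻¹' s)) (x y : X) (hxy : ∃ h : H, h • x = y) :
    μ.real {τ | f τ • x = y} = Nat.card (MulAction.stabilizer H y) / Nat.card H := by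
  have := Fintype.ofFinite H
  -- The fibers of `f` are translates of its kernel, so left invariance gives them equal measure,
  -- namely `1 / |H|` by `h1`.
  have hμ : ∀ h : H, μ.real (f ⁻¹' {h}) = μ.real (f ⁻¹' {1}) := fun h => by
    obtain ⟨g, rfl⟩ := hf h
    rw [measureReal_def, measureReal_def, ← measure_preimage_mul μ g⁻¹ (f ⁻¹' {1})]
    congr 2
    ext τ
    simp [inv_mul_eq_one, eq_comm (a := f τ)]
  have hs : ∀ s : Finset H, μ.real (f ⁻¹' s) = s.card * μ.real (f ⁻¹' {1}) := fun s => by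
    rw [← sum_measureReal_preimage_singleton s fun h _ => hm _]
    simp [hμ]
  have h1 : (Nat.card H : ℝ) * μ.real (f ⁻¹' {1}) = 1 := by
    have := hs Finset.univ
    rw [Finset.coe_univ, Set.preimage_univ, probReal_univ, Finset.card_univ] at this
    rw [Nat.card_eq_fintype_card, ← this]
  obtain ⟨h, rfl⟩ := hxy
  have hset : {τ | f τ • x = h • x} = f ⁻¹' (Finset.univ.filter fun k : H => k • x = h • x) := by
    ext; simp
  have hcard : (Finset.univ.filter fun k : H => k • x = h • x).card =
      Nat.card (MulAction.stabilizer H (h • x)) := by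
    rw [← Fintype.card_subtype, ← Nat.card_eq_fintype_card]
    -- The elements carrying `x` to `h • x` form the coset `Stab(h • x) * h`.
    refine Nat.card_congr ((Equiv.mulRight h⁻¹).subtypeEquiv fun k => ?_)
    simp [MulAction.mem_stabilizer_iff, mul_smul]
  rw [hset, hs, hcard, eq_div_iff (by exact_mod_cast Nat.card_pos.ne'), mul_assoc, mul_comm (μ.real _), h1, mul_one]

namespace PlacesOver
variable {K N : Type*} [Field K] [Field N] [Algebra K N] [IsGalois K N] {M : Set (Place K)}

lemma isProbabilityMeasure_galHaar : IsProbabilityMeasure (galHaar K N) :=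
  ⟨Measure.haarMeasure_self (K₀ := (⊤ : TopologicalSpace.PositiveCompacts Gal(N/K)))⟩

/-- The invariant measure of `ψ_L⁻¹(w)` is `[L_w : K_v] / [L : K]`. -/
theorem invariantMeasure_psi (L : FiniteGaloisIntermediateField K N) (w : Place L)
    (hw : w.under K ∈ M) :
    invariantMeasure N M (psi L ⁻¹' {w}) = localDegreeQuotient L w := by
  have := isProbabilityMeasure_galHaar (K := K) (N := N)
  have : (galHaar K N).IsMulLeftInvariant := Measure.isMulLeftInvariant_haarMeasure _
  have : (invariantMeasure N M).Regular := RealRMK.regular_rieszMeasure _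
  let v : M := ⟨w.under K, hw⟩
  have hv : (Place.psi L (basePoint N M v).1).under K = w.under K :=
    (Place.psi_under L _).trans (basePoint_mem v)
  have hreal : (invariantMeasure N M).real (psi L ⁻¹' {w}) =
      w.localDegree K / Module.finrank K L := by
    rw [invariantMeasure_of_isClopen (isClopen_psi L w) (isCompact_psi L w),
      finsum_eq_single _ v, Place.localDegree_eq_card_stabilizer, ← IsGalois.card_aut_eq_finrank,
      ← measureReal_smul_eq (galHaar K N) (AlgEquiv.restrictNormalHom L)
        (AlgEquiv.restrictNormalHom_surjective N)
        (fun s => (Place.continuous_restrict L s).measurableSet)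
        _ w (Place.exists_smul_eq_of_finite _ w hv)]
    · congr 1
      ext τ
      show Place.psi L (τ • (basePoint N M v).1) = w ↔ _
      rw [Place.psi_smul]
      rfl
    -- The orbit of `z_u` stays over `u`, so it meets `ψ_L⁻¹(w)` only if `u` is the place below `w`.
    · intro u hu
      rw [measureReal_eq_zero_iff]
      convert measure_empty (μ := galHaar K N)
      refine Set.eq_empty_of_forall_notMem fun τ hτ => hu (Subtype.ext ?_)
      have h1 : Place.psi L (τ • (basePoint N M u).1) = w := hτ
      show u.1 = w.under K
      rw [← h1, Place.psi_under, Place.under_smul]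
      exact (basePoint_mem u).symm
  have hpos : (0 : ℝ) < Module.finrank K L := by exact_mod_cast Module.finrank_pos
  -- The real-valued measure determines the measure only when the latter is finite; compactness and
  -- regularity ensure this.
  rw [← ENNReal.ofReal_toReal (isCompact_psi (M := M) L w).measure_ne_top, ← measureReal_def, hreal,
    ENNReal.ofReal_div_of_pos hpos, ENNReal.ofReal_natCast, ENNReal.ofReal_natCast]
  rfl

end PlacesOver

theorem theorem5 :
    (∀ (K N : Type u) [Field K] [Field N] [Algebra K N] [IsGalois K N]
      (M : Set (Place K)) (a : M → AbsoluteValue K ℝ), IsProper M a →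
      ∀ v ∈ M, ∀ (L : FiniteGaloisIntermediateField K N) (w : Place L), w.under K = v →
        PlacesOver.invariantMeasure N M (PlacesOver.psi L ⁻¹' {w}) =
          localDegreeQuotient L w) ∧
    (∀ (Qbar : Type u) [Field Qbar] [Algebra ℚ Qbar] [IsAlgClosure ℚ Qbar]
      (k : FiniteGaloisIntermediateField ℚ Qbar) (v : Place k),
      PlacesOver.invariantMeasure Qbar (Set.univ : Set (Place ℚ))
          {y | y.1.under k = v} =
        localDegreeQuotient k v) := by
  refine ⟨?_, ?_⟩
  · rintro K N _ _ _ _ M a - v hv L w rfl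
    exact PlacesOver.invariantMeasure_psi L w hv
  · intro Qbar _ _ _ k v
    -- `Y(k, v)` is `ψ_k⁻¹(v)` by definition, and every place of `ℚ` belongs to the chosen set of
    -- places.
    exact PlacesOver.invariantMeasure_psi k v (Set.mem_univ _)
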